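/- Consider a slotted wireless network given by a finite directed graph $G=(V,E)$ without directed cycles, $E\subseteq V\times V$, link capacities $c_e\in\mathbb Z_{\ge 0}$ (packets per slot) and a source $r\in V$. A *matching* is a set of links no two of which share an endpoint (directions ignored). In each slot $t=0,1,2,\dots$, $A(t)\in\mathbb Z_{\ge0}$ new packets arrive at $r$, where the $A(t)$ are i.i.d. with mean $\lambda$. A *policy* chooses in every slot a set of links to activate, which must be a matching (primary interference), and for each activated link $e=(i,j)$ a set of at most $c_e$ packets to forward to $j$ among those that $i$ has received in earlier slots; the choices may be random and may depend on the whole past and future. Let $R_v(T)$ be the number of distinct packets received by node $v$ in the first $T$ slots (for $v=r$ this includes the arrivals). The policy is a *broadcast policy of rate $\lambda$* if $\min_{v\in V}\liminf_{T\to\infty}R_v(T)/T=\lambda$ with probability one, where $\lambda$ is also the arrival rate. The *broadcast capacity* $\lambda^*\in[0,\infty]$ is the supremum of the arrival rates $\lambda$ for which there is a broadcast policy of rate $\lambda$. Then there are $k\le |E|+1$ distinct matchings $M_1,\dots,M_k$ and probabilities $p_1,\dots,p_k>0$ with $\sum_l p_l=1$ such that $\lambda^*$ is achieved by randomly activating these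 matchings with these probabilities. That is, for every finite rate $0\le\lambda\le\lambda^*$, for all i.i.d. arrivals of mean $\lambda$ and all i.i.d. selections $L(t)\in\{1,\dots,k\}$ with $\Pr(L(t)=l)=p_l$ on the same probability space, there is a broadcast policy of rate $\lambda$ that activates the matching $M_{L(t)}$ in every slot $t$. Moreover, with $\chi^{M}\in\{0,1\}^E$ the incidence vector of $M$, the average activation vector $\beta^*=\sum_l p_l\chi^{M_l}$ maximizes $\min_{v\ne r}\sum_{e=(i,v)\in E}c_e\beta_e$ over all $\beta$ in the matching polytope $\mathrm{conv}\{\chi^M : M \text{ a matching of } G\}$, and the maximum value is $\lambda^*$ (if $V=\{r\}$, the minimum over the empty set is $\infty$). -/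

import Mathlib

open MeasureTheory ProbabilityTheory Filter
open scoped ENNReal NNReal

/-- A time-slotted wireless network `(G(V,E), c, S)` with a source node. -/
structure WirelessNetwork (V : Type*) where
  /-- the set `E` of directed links; `(i, j)` is a link from `i` to `j` -/
  links : Finset (V × V)
  /-- the number of packets that an activated link can carry in one slot -/
  cap : links → ℕ
  /-- the feasible activations: sets of links that can be activated simultaneously -/
  feasible : Set (Finset links)
  /-- the node `r` at which the packets arrive -/
  source : V

namespace WirelessNetwork

variable {V : Type*} (N : WirelessNetwork V)

/-- The underlying directed graph has no directed cycle. -/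
def IsDAG : Prop :=
  ∀ v : V, ¬ Relation.TransGen (fun i j : V => (i, j) ∈ N.links) v v

/-- A matching (directions ignored): distinct links of the set have no common endpoint. -/
def IsMatching (M : Finset N.links) : Prop :=
  ∀ e ∈ M, ∀ f ∈ M, e ≠ f →
    e.1.1 ≠ f.1.1 ∧ e.1.1 ≠ f.1.2 ∧ e.1.2 ≠ f.1.1 ∧ e.1.2 ≠ f.1.2

/-- Primary interference: the feasible activations are exactly the matchings. -/
def PrimaryInterference : Prop :=
  N.feasible = {M | N.IsMatching M}

/-- The links entering the node `v`. -/
def inLinks [DecidableEq V] (v : V) : Finset N.links :=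
  Finset.univ.filter fun e => e.1.2 = v

/-- The set of packets held by each node at the beginning of slot `t`, on one sample path.
`a t` is the number of packets that arrive at the source in slot `t`; packets are numbered
`0, 1, 2, …` in the order of their arrival. `f t e` is the set of packets forwarded over the
link `e` in slot `t`. -/
def held [DecidableEq V] (a : ℕ → ℕ) (f : ℕ → N.links → Finset ℕ) : ℕ → V → Finset ℕ
  | 0, _ => ∅
  | t + 1, v =>
      (held a f t v ∪ (N.inLinks v).biUnion (f t)) ∪
        (if v = N.source then
          Finset.Ico (∑ s ∈ Finset.range t, a s) (∑ s ∈ Finset.range (t + 1), a s) else ∅)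

/-- A scheduling policy, for arrivals `A` on a probability space `Ω`. Both the activations and the
forwarded packets may depend on `ω` in any measurable way, so the policy may be randomized and
may use all past and future information. -/
structure Policy [DecidableEq V] {Ω : Type*} [MeasurableSpace Ω] (A : ℕ → Ω → ℕ) where
  /-- the set of links activated in slot `t` -/
  act : ℕ → Ω → Finset N.links
  /-- the set of packets forwarded over a link in slot `t` -/
  fwd : ℕ → Ω → N.links → Finset ℕ
  act_feasible : ∀ t ω, act t ω ∈ N.feasible
  /-- only activated links forward packets -/
  fwd_act : ∀ t ω e, e ∉ act t ω → fwd t ω e = ∅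
  /-- the link capacity constraint -/
  fwd_cap : ∀ t ω e, (fwd t ω e).card ≤ N.cap e
  /-- a node can only forward packets that it has received in previous slots -/
  fwd_held : ∀ t ω e, fwd t ω e ⊆ N.held (fun s => A s ω) (fun s => fwd s ω) t e.1.1
  measurable_act : ∀ t M, MeasurableSet {ω | act t ω = M}
  measurable_fwd : ∀ t e F, MeasurableSet {ω | fwd t ω e = F}

/-- `R_v(T)`: the number of distinct packets received by the node `v` in the first `T` slots. -/
def Policy.received [DecidableEq V] {N : WirelessNetwork V} {Ω : Type*} [MeasurableSpace Ω]
    {A : ℕ → Ω → ℕ} (pol : N.Policy A) (v : V) (T : ℕ) (ω : Ω) : ℕ :=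
  (N.held (fun s => A s ω) (fun s => pol.fwd s ω) T v).card

/-- All nodes receive distinct packets at rate `rate`:
`min_v liminf_{T → ∞} R_v(T) / T = rate` with probability one. -/
def Policy.IsBroadcastOfRate [DecidableEq V] {N : WirelessNetwork V} {Ω : Type*}
    [MeasurableSpace Ω] {A : ℕ → Ω → ℕ} (pol : N.Policy A) (P : Measure Ω) (rate : ℝ≥0) : Prop :=
  ∀ᵐ ω ∂P, (⨅ v : V, liminf (fun T : ℕ => (pol.received v T ω : ℝ≥0∞) / (T : ℝ≥0∞)) atTop)
    = (rate : ℝ≥0∞)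

end WirelessNetwork

/-- The numbers of arrivals in the slots are i.i.d. with mean `rate`. -/
structure IsArrivalProcess {Ω : Type*} [MeasurableSpace Ω] (P : Measure Ω) (A : ℕ → Ω → ℕ)
    (rate : ℝ≥0) : Prop where
  measurable : ∀ t, Measurable (A t)
  indep : iIndepFun A P
  identDistrib : ∀ t, IdentDistrib (A t) (A 0) P P
  mean : ∫⁻ ω, (A 0 ω : ℝ≥0∞) ∂P = (rate : ℝ≥0∞)

/-- The random indices `L t` are i.i.d., and each of them has the value `l` with probability
`p l`. -/
structure IsIIDSelection {Ω : Type*} [MeasurableSpace Ω] (P : Measure Ω) {k : ℕ}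
    (L : ℕ → Ω → Fin k) (p : Fin k → ℝ) : Prop where
  measurable : ∀ t, Measurable (L t)
  indep : iIndepFun L P
  law : ∀ t l, P {ω | L t ω = l} = ENNReal.ofReal (p l)

namespace WirelessNetwork

variable {V : Type*} (N : WirelessNetwork V)

/-- For some arrival process of mean `rate` there is a broadcast policy of rate `rate`. -/
def Supports [DecidableEq V] (rate : ℝ≥0) : Prop :=
  ∃ (Ω : Type) (_ : MeasurableSpace Ω) (P : Measure Ω) (A : ℕ → Ω → ℕ),
    IsProbabilityMeasure P ∧ IsArrivalProcess P A rate ∧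
      ∃ pol : N.Policy A, pol.IsBroadcastOfRate P rate

/-- The broadcast capacity `λ*`: the supremum, in `[0, ∞]`, of the arrival rates `rate` for which
there is a broadcast policy of rate `rate`. -/
noncomputable def broadcastCapacity [DecidableEq V] : ℝ≥0∞ :=
  ⨆ (rate : ℝ≥0) (_ : N.Supports rate), (rate : ℝ≥0∞)

/-- The incidence vector `χ^M ∈ {0,1}^E` of a set of links. -/
noncomputable def incidence (M : Finset N.links) : N.links → ℝ :=
  Set.indicator (M : Set N.links) 1

/-- The matching polytope: the convex hull of the incidence vectors of the matchings. -/
def matchingPolytope : Set (N.links → ℝ) :=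
  convexHull ℝ (N.incidence '' {M | N.IsMatching M})

/-- `min_{v ≠ r} ∑_{e ∈ δ_in(v)} c_e β_e`, the largest `λ` for which `(λ, β)` satisfies the
constraints `λ ≤ ∑_{e ∈ δ_in(v)} c_e β_e` for all `v ≠ r`. -/
noncomputable def minInflow [DecidableEq V] (β : N.links → ℝ) : ℝ≥0∞ :=
  ⨅ (v : V) (_ : v ≠ N.source), ENNReal.ofReal (∑ e ∈ N.inLinks v, (N.cap e : ℝ) * β e)

end WirelessNetwork

/-! Converse: over `T` slots the empirical average of the activated matchings lies in the matching
polytope, and a node other than the source receives at most the capacity activated into it. So at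
each finite `T`, on each sample path, the rates `R_v(T)/T`, `v ≠ r`, are bounded by the inflows of
one polytope point (`exists_received_div_le`), and the capacity by the maximum of `minInflow`.

Achievability: the maximum is attained, and Carathéodory's theorem writes a maximizer with at most
`|E| + 1` matchings. They are activated at random and packets are forwarded in order, so that each
node holds an initial segment of the packets (`held_inOrderFwd`) and a single counter describes it.
Each counter is a queue fed by the smallest counter among its in-neighbours, with service rate at
least `λ`. Such a queue passes on the rate `λ` (`GrowsAtLeast.queue`), and induction along the DAG
reaches every node. The strong law supplies the arrival and service rates. -/

/-! ### Linear growth of deterministic queues -/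

theorem exists_abs_sub_le_of_tendsto_div {u : ℕ → ℝ} {x : ℝ}
    (h : Tendsto (fun T : ℕ => u T / T) atTop (nhds x)) {ε : ℝ} (hε : 0 < ε) :
    ∃ C : ℝ, 0 ≤ C ∧ ∀ T : ℕ, |u T - x * T| ≤ ε * T + C := by
  obtain ⟨n, hn⟩ := Metric.tendsto_atTop.1 h ε hε
  refine ⟨∑ T ∈ Finset.range (n + 1), |u T - x * T|,
    Finset.sum_nonneg fun _ _ => abs_nonneg _, fun T => ?_⟩
  rcases lt_or_ge T (n + 1) with hT | hT
  · have := Finset.single_le_sum (f := fun T : ℕ => |u T - x * T|)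
      (fun _ _ => abs_nonneg _) (Finset.mem_range.2 hT)
    have : 0 ≤ ε * T := by positivity
    linarith
  · have hT0 : (0 : ℝ) < T := by exact_mod_cast (by omega : 0 < T)
    have h1 := hn T (by omega)
    rw [Real.dist_eq] at h1
    have h2 : u T - x * T = (u T / T - x) * T := by field_simp
    have h3 : 0 ≤ ∑ T ∈ Finset.range (n + 1), |u T - x * T| :=
      Finset.sum_nonneg fun _ _ => abs_nonneg _
    rw [h2, abs_mul, abs_of_pos hT0]
    nlinarith

/-- The sequence `u` grows at least linearly with slope `x`, up to a sublinear error. -/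
def GrowsAtLeast (u : ℕ → ℝ) (x : ℝ) : Prop :=
  ∀ ε > 0, ∃ C : ℝ, 0 ≤ C ∧ ∀ T : ℕ, (x - ε) * T - C ≤ u T

theorem GrowsAtLeast.of_tendsto_div {u : ℕ → ℝ} {x : ℝ}
    (h : Tendsto (fun T : ℕ => u T / T) atTop (nhds x)) : GrowsAtLeast u x := by
  intro ε hε
  obtain ⟨C, hC, hu⟩ := exists_abs_sub_le_of_tendsto_div h hε
  exact ⟨C, hC, fun T => by have := (abs_le.1 (hu T)).1; linarith⟩

/-- A queue with input `m`, cumulative service `S` of rate `y` and output `R` has the output rate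
`x` whenever the input rate is at least `x` and `x ≤ y`. -/
theorem GrowsAtLeast.queue {R S m : ℕ → ℝ} {x y : ℝ} (hx : 0 ≤ x) (hxy : x ≤ y)
    (hm : GrowsAtLeast m x) (hS : Tendsto (fun T : ℕ => S T / T) atTop (nhds y))
    (hS0 : S 0 = 0) (hR0 : 0 ≤ R 0)
    (hR : ∀ t, min (R t + (S (t + 1) - S t)) (m t) ≤ R (t + 1)) : GrowsAtLeast R x := by
  intro ε hε
  obtain ⟨C₁, hC₁, hm⟩ := hm (ε / 3) (by linarith)
  obtain ⟨C₂, hC₂, hS⟩ := exists_abs_sub_le_of_tendsto_div hS (show 0 < ε / 3 by linarith)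
  -- Comparison with `S` plus a line lets the service branch pass: the increments of `S` cancel and
  -- the remaining slope is negative because `x ≤ y`. The summand `x` pays for the one-slot delay
  -- between `m t` and `R (t + 1)`.
  have key : ∀ t : ℕ, S t + (x - y - 2 * (ε / 3)) * t - (C₁ + C₂ + x) ≤ R t := by
    intro t
    induction t with
    | zero => simp only [Nat.cast_zero]; linarith
    | succ t ih =>
      refine le_trans (le_min ?_ ?_) (hR t)
      · push_cast; nlinarith
      · have h1 := hm t
        have h2 := (abs_le.1 (hS (t + 1))).2
        push_cast at h2 ⊢
        nlinarith
  refine ⟨C₁ + C₂ + x + C₂, by positivity, fun T => ?_⟩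
  have h1 := key T
  have h2 := (abs_le.1 (hS T)).1
  linarith

theorem GrowsAtLeast.of_exists_le {ι : Type*} {s : Finset ι} {u : ι → ℕ → ℝ} {x : ℝ}
    (h : ∀ i ∈ s, GrowsAtLeast (u i) x) {m : ℕ → ℝ} (hm : ∀ t, ∃ i ∈ s, u i t ≤ m t) :
    GrowsAtLeast m x := by
  intro ε hε
  choose! C hC hu using fun i hi => h i hi ε hε
  -- The index `i` may change with the time, so the constant must dominate every `C i`.
  refine ⟨∑ i ∈ s, C i, Finset.sum_nonneg hC, fun T => ?_⟩
  obtain ⟨i, hi, hiT⟩ := hm T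
  have := Finset.single_le_sum hC hi
  have := hu i hi T
  linarith

theorem GrowsAtLeast.le_liminf {u : ℕ → ℕ} {x : ℝ≥0} (h : GrowsAtLeast (fun T => (u T : ℝ)) x) :
    (x : ℝ≥0∞) ≤ liminf (fun T : ℕ => (u T : ℝ≥0∞) / (T : ℝ≥0∞)) atTop := by
  refine ENNReal.le_of_forall_nnreal_lt fun y hy => ?_
  have hyx : (y : ℝ) < x := by exact_mod_cast hy
  obtain ⟨C, hC, hu⟩ := h ((x - y) / 2) (by linarith)
  refine le_liminf_of_le (by isBoundedDefault) ?_
  obtain ⟨n, hn⟩ := exists_nat_ge (C / ((x - y) / 2))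
  filter_upwards [eventually_ge_atTop (n + 1)] with T hT
  have hT0 : (T : ℝ≥0∞) ≠ 0 := by simp; omega
  rw [ENNReal.le_div_iff_mul_le (Or.inl hT0) (Or.inl (ENNReal.natCast_ne_top T))]
  have hnT : (n : ℝ) ≤ T := by exact_mod_cast (by omega : n ≤ T)
  have h1 := hu T
  have h2 : C ≤ (x - y) / 2 * T := by
    rw [div_le_iff₀ (by linarith)] at hn
    nlinarith
  have h3 : (y : ℝ) * T ≤ u T := by linarith
  exact_mod_cast h3

theorem liminf_natCast_div_of_tendsto {u : ℕ → ℕ} {x : ℝ≥0}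
    (h : Tendsto (fun T : ℕ => (u T : ℝ) / T) atTop (nhds x)) :
    liminf (fun T : ℕ => (u T : ℝ≥0∞) / (T : ℝ≥0∞)) atTop = x := by
  refine Tendsto.liminf_eq ?_
  have h1 := ENNReal.tendsto_ofReal h
  rw [ENNReal.ofReal_coe_nnreal] at h1
  refine h1.congr' ?_
  filter_upwards [eventually_gt_atTop 0] with T hT
  rw [ENNReal.ofReal_div_of_pos (by exact_mod_cast hT), ENNReal.ofReal_natCast,
    ENNReal.ofReal_natCast]

namespace WirelessNetwork

/-! ### In-order forwarding on one sample path -/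

section Paths

variable {V : Type*} [DecidableEq V] (N : WirelessNetwork V)

theorem mem_inLinks {v : V} {e : N.links} : e ∈ N.inLinks v ↔ e.1.2 = v := by
  simp [inLinks]

/-- The number of packets that the links of `s` can carry to the node `v` in one slot. -/
def inCap (s : Finset N.links) (v : V) : ℕ :=
  ∑ e ∈ N.inLinks v, if e ∈ s then N.cap e else 0

/-- The number of packets held by each node under in-order forwarding: a node may only receive the
packets that all its in-neighbours hold. -/
noncomputable def inOrder (a : ℕ → ℕ) (s : ℕ → Finset N.links) : ℕ → V → ℕ
  | 0, _ => 0
  | t + 1, v =>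
      if v = N.source then ∑ i ∈ Finset.range (t + 1), a i
      else inOrder a s t v +
        min (N.inCap (s t) v) ((⨅ e : N.inLinks v, inOrder a s t e.1.1.1) - inOrder a s t v)

/-- The packets forwarded over each link under in-order forwarding. -/
noncomputable def inOrderFwd (a : ℕ → ℕ) (s : ℕ → Finset N.links) (t : ℕ) (e : N.links) :
    Finset ℕ :=
  if e ∈ s t ∧ e.1.2 ≠ N.source then
    Finset.Ico (N.inOrder a s t e.1.2) (N.inOrder a s (t + 1) e.1.2) else ∅

variable {N} {a : ℕ → ℕ} {s : ℕ → Finset N.links}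

theorem inOrder_source (t : ℕ) : N.inOrder a s t N.source = ∑ i ∈ Finset.range t, a i := by
  cases t <;> simp [inOrder]

theorem inOrder_succ_of_ne {v : V} (hv : v ≠ N.source) (t : ℕ) :
    N.inOrder a s (t + 1) v = N.inOrder a s t v +
      min (N.inCap (s t) v) ((⨅ e : N.inLinks v, N.inOrder a s t e.1.1.1) - N.inOrder a s t v) := by
  rw [inOrder, if_neg hv]

theorem inOrder_le_succ (t : ℕ) (v : V) : N.inOrder a s t v ≤ N.inOrder a s (t + 1) v := by
  by_cases hv : v = N.source
  · subst hv
    rw [inOrder_source, inOrder_source]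
    exact Finset.sum_le_sum_of_subset (Finset.range_mono (Nat.le_succ t))
  · rw [inOrder_succ_of_ne hv]
    exact Nat.le_add_right _ _

/-- A matching has at most one link into a node, so a counter's whole increment fits on that link.
-/
theorem inCap_eq_cap {M : Finset N.links} (hM : N.IsMatching M) {e : N.links} (he : e ∈ M) :
    N.inCap M e.1.2 = N.cap e := by
  rw [inCap, Finset.sum_eq_single e]
  · rw [if_pos he]
  · intro f hf hfe
    rw [if_neg]
    intro hfM
    exact (hM f hfM e he hfe).2.2.2 (N.mem_inLinks.1 hf)
  · intro h
    exact absurd (N.mem_inLinks.2 rfl) h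

theorem inCap_eq_zero {M : Finset N.links} {v : V} (h : ∀ e ∈ M, e.1.2 ≠ v) : N.inCap M v = 0 :=
  Finset.sum_eq_zero fun e he => if_neg fun heM => h e heM (N.mem_inLinks.1 he)

theorem biUnion_inOrderFwd_eq_empty {t : ℕ} {v : V} (h : ∀ e ∈ s t, e.1.2 = v → v = N.source) :
    (N.inLinks v).biUnion (N.inOrderFwd a s t) = ∅ := by
  refine Finset.eq_empty_of_forall_notMem fun n hn => ?_
  obtain ⟨e, he, hne⟩ := Finset.mem_biUnion.1 hn
  rw [N.mem_inLinks] at he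
  rw [inOrderFwd, if_neg] at hne
  · simp at hne
  · exact fun h1 => h1.2 (he.trans (h e h1.1 he))

/-- An active link into `v ≠ r` carries exactly the interval between two consecutive counters of
`v`. Without such a link `inCap` vanishes and the counter stands still. -/
theorem held_inOrderFwd (t : ℕ) (v : V) :
    N.held a (N.inOrderFwd a s) t v = Finset.range (N.inOrder a s t v) := by
  induction t generalizing v with
  | zero => simp [held, inOrder]
  | succ t ih =>
    rw [held, ih]
    by_cases hv : v = N.source
    · subst hv
      have h : (N.inLinks N.source).biUnion (N.inOrderFwd a s t) = ∅ :=
        biUnion_inOrderFwd_eq_empty fun _ _ _ => rfl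
      have h' := inOrder_le_succ (a := a) (s := s) t N.source
      rw [inOrder_source, inOrder_source] at h'
      rw [h, if_pos rfl, inOrder_source, inOrder_source]
      ext n
      simp only [Finset.mem_union, Finset.mem_range, Finset.mem_Ico, Finset.notMem_empty, or_false]
      omega
    · rw [if_neg hv, Finset.union_empty]
      have h' := inOrder_le_succ (a := a) (s := s) t v
      by_cases h : ∃ e ∈ s t, e.1.2 = v
      · obtain ⟨e, hes, rfl⟩ := h
        ext n
        simp only [Finset.mem_union, Finset.mem_range, Finset.mem_biUnion, N.mem_inLinks]
        constructor
        · rintro (h | ⟨f, hf, hn⟩)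
          · omega
          · rw [inOrderFwd] at hn
            split_ifs at hn
            · rw [hf, Finset.mem_Ico] at hn
              exact hn.2
            · simp at hn
        · intro hn
          by_cases hlt : n < N.inOrder a s t e.1.2
          · exact Or.inl hlt
          · refine Or.inr ⟨e, rfl, ?_⟩
            rw [inOrderFwd, if_pos ⟨hes, hv⟩, Finset.mem_Ico]
            omega
      · push Not at h
        have h0 : (N.inLinks v).biUnion (N.inOrderFwd a s t) = ∅ :=
          biUnion_inOrderFwd_eq_empty fun e he hev => absurd hev (h e he)
        rw [h0, Finset.union_empty, inOrder_succ_of_ne hv, inCap_eq_zero h]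
        simp

theorem card_inOrderFwd_le {t : ℕ} (hs : N.IsMatching (s t)) (e : N.links) :
    (N.inOrderFwd a s t e).card ≤ N.cap e := by
  rw [inOrderFwd]
  split_ifs with h
  · rw [Nat.card_Ico, inOrder_succ_of_ne h.2, inCap_eq_cap hs h.1]
    omega
  · simp

theorem inOrderFwd_subset_held (t : ℕ) (e : N.links) :
    N.inOrderFwd a s t e ⊆ N.held a (N.inOrderFwd a s) t e.1.1 := by
  rw [held_inOrderFwd]
  intro n hn
  rw [inOrderFwd] at hn
  split_ifs at hn with h
  · rw [Finset.mem_Ico, inOrder_succ_of_ne h.2] at hn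
    have h1 : (⨅ f : N.inLinks e.1.2, N.inOrder a s t f.1.1.1) ≤ N.inOrder a s t e.1.1 :=
      ciInf_le (OrderBot.bddBelow _) (⟨e, N.mem_inLinks.2 rfl⟩ : N.inLinks e.1.2)
    rw [Finset.mem_range]
    omega
  · simp at hn

theorem growsAtLeast_inOrder [Fintype V] (hdag : N.IsDAG) {x : ℝ} (hx : 0 ≤ x) {β : N.links → ℝ}
    (ha : GrowsAtLeast (fun T => ((∑ i ∈ Finset.range T, a i : ℕ) : ℝ)) x)
    (hs : ∀ e, Tendsto (fun T : ℕ => (∑ t ∈ Finset.range T, if e ∈ s t then (1 : ℝ) else 0) / T)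
      atTop (nhds (β e)))
    (hβ : ∀ v, v ≠ N.source → x ≤ ∑ e ∈ N.inLinks v, (N.cap e : ℝ) * β e) (v : V) :
    GrowsAtLeast (fun T => (N.inOrder a s T v : ℝ)) x := by
  -- On a finite vertex set, acyclicity makes reachability well-founded.
  have : Std.Irrefl (Relation.TransGen fun i j : V => (i, j) ∈ N.links) := ⟨hdag⟩
  induction v using (Finite.wellFounded_of_trans_of_irrefl
    (Relation.TransGen fun i j : V => (i, j) ∈ N.links)).induction with
  | _ v ih =>
  by_cases hv : v = N.source
  · subst hv
    simpa only [inOrder_source] using ha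
  have hxv := hβ v hv
  -- With no in-links the inflow is `0`, which forces `x = 0`; otherwise the infimum is attained at
  -- some in-neighbour.
  rcases (N.inLinks v).eq_empty_or_nonempty with h0 | hne
  · rw [h0, Finset.sum_empty] at hxv
    have hx0 : x = 0 := le_antisymm hxv hx
    intro ε hε
    refine ⟨0, le_rfl, fun T => le_trans ?_ (Nat.cast_nonneg _)⟩
    rw [hx0]
    have : 0 ≤ ε * T := by positivity
    linarith
  have : Nonempty (N.inLinks v) := hne.to_subtype
  refine GrowsAtLeast.queue (S := fun T => ((∑ t ∈ Finset.range T, N.inCap (s t) v : ℕ) : ℝ))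
    (m := fun t => ((⨅ e : N.inLinks v, N.inOrder a s t e.1.1.1 : ℕ) : ℝ)) hx hxv ?_ ?_
    (by simp) (Nat.cast_nonneg _) ?_
  · refine GrowsAtLeast.of_exists_le (s := N.inLinks v) (u := fun e t => (N.inOrder a s t e.1.1 : ℝ)) ?_ ?_
    · intro e he
      refine ih e.1.1 (Relation.TransGen.single ?_)
      rw [← N.mem_inLinks.1 he]
      exact e.2
    · intro t
      obtain ⟨e, he⟩ := ciInf_mem fun e : N.inLinks v => N.inOrder a s t e.1.1.1
      exact ⟨e.1, e.2, by rw [← he]⟩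
  · have h := tendsto_finsetSum (N.inLinks v) fun e _ => (hs e).const_mul (N.cap e : ℝ)
    refine h.congr fun T => ?_
    simp only [inCap]
    push_cast
    rw [Finset.sum_comm, Finset.sum_div]
    refine Finset.sum_congr rfl fun e _ => ?_
    rw [← mul_div_assoc, Finset.mul_sum]
    simp
  · intro t
    rw [Finset.sum_range_succ, inOrder_succ_of_ne hv]
    push_cast
    rw [add_sub_cancel_left]
    norm_cast
    omega

end Paths

/-! ### The randomized in-order policy -/

section Achievability

variable {V : Type*} [DecidableEq V] {N : WirelessNetwork V} {Ω : Type*} [MeasurableSpace Ω]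
  {A : ℕ → Ω → ℕ} {k : ℕ} {L : ℕ → Ω → Fin k} {M : Fin k → Finset N.links}

theorem measurable_inOrder (hA : ∀ t, Measurable (A t)) (hL : ∀ t, Measurable (L t)) (t : ℕ)
    (v : V) : Measurable fun ω => N.inOrder (fun i => A i ω) (fun i => M (L i ω)) t v := by
  induction t generalizing v with
  | zero => exact measurable_const
  | succ t ih =>
    by_cases hv : v = N.source
    · subst hv
      simp only [inOrder_source]
      exact Finset.measurable_sum _ fun i _ => hA i
    · simp only [inOrder_succ_of_ne hv]
      have h : Measurable fun ω => N.inCap (M (L t ω)) v :=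
        (measurable_of_finite fun l => N.inCap (M l) v).comp (hL t)
      exact (ih v).add (h.min ((Measurable.iInf fun e : N.inLinks v => ih e.1.1.1).sub (ih v)))

/-- The policy that activates `M (L t)` in the slot `t` and forwards packets in order. -/
noncomputable def inOrderPolicy (hN : ∀ l, M l ∈ N.feasible) (hM : ∀ l, N.IsMatching (M l))
    (hA : ∀ t, Measurable (A t)) (hL : ∀ t, Measurable (L t)) : N.Policy A where
  act t ω := M (L t ω)
  fwd t ω := N.inOrderFwd (fun i => A i ω) (fun i => M (L i ω)) t
  act_feasible t ω := hN _
  fwd_act t ω e he := if_neg fun h => he h.1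
  fwd_cap t ω e := card_inOrderFwd_le (hM _) e
  fwd_held t ω e := inOrderFwd_subset_held t e
  measurable_act t F := hL t (MeasurableSet.of_discrete (s := {l | M l = F}))
  measurable_fwd t e F := by
    have h : Measurable fun ω => (L t ω,
        N.inOrder (fun i => A i ω) (fun i => M (L i ω)) t e.1.2,
        N.inOrder (fun i => A i ω) (fun i => M (L i ω)) (t + 1) e.1.2) :=
      (hL t).prodMk ((measurable_inOrder hA hL t _).prodMk (measurable_inOrder hA hL (t + 1) _))
    exact h (MeasurableSet.of_discrete (s := {q : Fin k × ℕ × ℕ |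
      (if e ∈ M q.1 ∧ e.1.2 ≠ N.source then Finset.Ico q.2.1 q.2.2 else ∅) = F}))

theorem received_inOrderPolicy (hN : ∀ l, M l ∈ N.feasible) (hM : ∀ l, N.IsMatching (M l))
    (hA : ∀ t, Measurable (A t)) (hL : ∀ t, Measurable (L t)) (v : V) (T : ℕ) (ω : Ω) :
    (inOrderPolicy hN hM hA hL).received v T ω =
      N.inOrder (fun i => A i ω) (fun i => M (L i ω)) T v := by
  change (N.held _ (N.inOrderFwd _ _) T v).card = _
  rw [held_inOrderFwd, Finset.card_range]

end Achievability

end WirelessNetwork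

/-! ### Strong laws and existence of the processes -/

theorem IsArrivalProcess.ae_tendsto {Ω : Type*} [MeasurableSpace Ω] {P : Measure Ω}
    {A : ℕ → Ω → ℕ} {rate : ℝ≥0} (h : IsArrivalProcess P A rate) :
    ∀ᵐ ω ∂P, Tendsto (fun T : ℕ => ((∑ i ∈ Finset.range T, A i ω : ℕ) : ℝ) / T) atTop
      (nhds rate) := by
  have hm : Measurable fun n : ℕ => (n : ℝ) := measurable_from_nat
  have hlin : ∫⁻ ω, ENNReal.ofReal (A 0 ω : ℝ) ∂P = rate := by
    simpa only [ENNReal.ofReal_natCast] using h.mean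
  have hpos : 0 ≤ᵐ[P] fun ω => (A 0 ω : ℝ) := Eventually.of_forall fun ω => Nat.cast_nonneg _
  have hmeas : AEStronglyMeasurable (fun ω => (A 0 ω : ℝ)) P :=
    (hm.comp (h.measurable 0)).aestronglyMeasurable
  have hint : Integrable (fun ω => (A 0 ω : ℝ)) P := by
    refine ⟨hmeas, ?_⟩
    rw [hasFiniteIntegral_iff_ofReal hpos, hlin]
    exact ENNReal.coe_lt_top
  have hmean : ∫ ω, (A 0 ω : ℝ) ∂P = rate := by
    rw [integral_eq_lintegral_of_nonneg_ae hpos hmeas, hlin, ENNReal.coe_toReal]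
  have := strong_law_ae_real (fun t ω => (A t ω : ℝ)) hint
    (fun i j hij => (h.indep.indepFun hij).comp hm hm) fun i => (h.identDistrib i).comp hm
  simpa only [hmean, Nat.cast_sum] using this

theorem IsIIDSelection.identDistrib {Ω : Type*} [MeasurableSpace Ω] {P : Measure Ω} {k : ℕ}
    {L : ℕ → Ω → Fin k} {p : Fin k → ℝ} (h : IsIIDSelection P L p) (t s : ℕ) :
    IdentDistrib (L t) (L s) P P := by
  refine ⟨(h.measurable t).aemeasurable, (h.measurable s).aemeasurable, ?_⟩
  refine Measure.ext_of_singleton fun l => ?_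
  rw [Measure.map_apply (h.measurable t) (measurableSet_singleton l),
    Measure.map_apply (h.measurable s) (measurableSet_singleton l)]
  exact (h.law t l).trans (h.law s l).symm

theorem IsIIDSelection.ae_tendsto {Ω : Type*} [MeasurableSpace Ω] {P : Measure Ω}
    [IsProbabilityMeasure P] {k : ℕ} {L : ℕ → Ω → Fin k} {p : Fin k → ℝ} (hp : ∀ l, 0 ≤ p l)
    (h : IsIIDSelection P L p) (g : Fin k → ℝ) :
    ∀ᵐ ω ∂P, Tendsto (fun T : ℕ => (∑ t ∈ Finset.range T, g (L t ω)) / T) atTop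
      (nhds (∑ l, p l * g l)) := by
  have hg : Measurable g := measurable_of_finite g
  have hint : Integrable g (P.map (L 0)) := by
    have := Measure.isProbabilityMeasure_map (μ := P) (h.measurable 0).aemeasurable
    exact Integrable.of_finite
  have hmean : ∫ ω, g (L 0 ω) ∂P = ∑ l, p l * g l := by
    rw [← integral_map (h.measurable 0).aemeasurable hint.aestronglyMeasurable,
      integral_fintype hint]
    refine Finset.sum_congr rfl fun l _ => ?_
    rw [measureReal_def, Measure.map_apply (h.measurable 0) (measurableSet_singleton l)]
    change (P {ω | L 0 ω = l}).toReal • g l = _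
    rw [h.law, ENNReal.toReal_ofReal (hp l), smul_eq_mul]
  have := strong_law_ae_real (fun t ω => g (L t ω)) (hint.comp_measurable (h.measurable 0))
    (fun i j hij => (h.indep.indepFun hij).comp hg hg) fun i => (h.identDistrib i 0).comp hg
  simpa only [hmean] using this

/-- Arrivals of any given mean and selections of any given law exist on a common probability
space. -/
theorem exists_isArrivalProcess_isIIDSelection (rate : ℝ≥0) {k : ℕ} {p : Fin k → ℝ}
    (hp : ∀ l, 0 ≤ p l) (hp1 : ∑ l, p l = 1) :
    ∃ (Ω : Type) (_ : MeasurableSpace Ω) (P : Measure Ω) (A : ℕ → Ω → ℕ) (L : ℕ → Ω → Fin k),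
      IsProbabilityMeasure P ∧ IsArrivalProcess P A rate ∧ IsIIDSelection P L p := by
  -- Arrivals are `n` with probability `rate / n` and `0` otherwise; the `+ 1` keeps `n` nonzero.
  obtain ⟨n, hn⟩ := exists_nat_ge (rate + 1)
  have hn0 : (n : ℝ≥0) ≠ 0 := by
    intro h
    rw [h] at hn
    exact absurd hn (not_le.2 (by positivity))
  have hq : rate / n ≤ 1 := div_le_one_of_le₀ (le_trans le_self_add hn) (zero_le)
  let ν : Measure ℕ := ((rate / n : ℝ≥0) : ℝ≥0∞) • Measure.dirac n +
    ((1 - rate / n : ℝ≥0) : ℝ≥0∞) • Measure.dirac 0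
  have hν : IsProbabilityMeasure ν := by
    constructor
    simp only [ν, Measure.add_apply, Measure.smul_apply, measure_univ, smul_eq_mul, mul_one]
    rw [← ENNReal.coe_add, add_tsub_cancel_of_le hq, ENNReal.coe_one]
  let π : PMF (Fin k) := PMF.ofFintype (fun l => ENNReal.ofReal (p l)) (by
    rw [← ENNReal.ofReal_sum_of_nonneg fun l _ => hp l, hp1, ENNReal.ofReal_one])
  let Q : Measure (ℕ × Fin k) := ν.prod π.toMeasure
  have h1 : ∀ t : ℕ, Measurable fun ω : ℕ → ℕ × Fin k => ω t := fun t => measurable_pi_apply t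
  have hA : ∀ t, Measure.map (fun ω : ℕ → ℕ × Fin k => (ω t).1)
      (Measure.infinitePi fun _ => Q) = ν := fun t => by
    rw [← Function.comp_def Prod.fst, ← Measure.map_map measurable_fst (h1 t),
      Measure.infinitePi_map_eval, ← Measure.fst, Measure.fst_prod]
  have hL : ∀ t, Measure.map (fun ω : ℕ → ℕ × Fin k => (ω t).2)
      (Measure.infinitePi fun _ => Q) = π.toMeasure := fun t => by
    rw [← Function.comp_def Prod.snd, ← Measure.map_map measurable_snd (h1 t),
      Measure.infinitePi_map_eval, ← Measure.snd, Measure.snd_prod]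
  refine ⟨ℕ → ℕ × Fin k, inferInstance, Measure.infinitePi fun _ => Q, fun t ω => (ω t).1,
    fun t ω => (ω t).2, inferInstance, ⟨fun t => measurable_fst.comp (h1 t), ?_, fun t => ?_, ?_⟩,
    ⟨fun t => measurable_snd.comp (h1 t), ?_, fun t l => ?_⟩⟩
  · exact iIndepFun_infinitePi (X := fun _ => Prod.fst) fun _ => measurable_fst
  · exact ⟨(measurable_fst.comp (h1 t)).aemeasurable, (measurable_fst.comp (h1 0)).aemeasurable,
      (hA t).trans (hA 0).symm⟩
  · have := lintegral_map (μ := Measure.infinitePi fun _ : ℕ => Q)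
      (measurable_from_nat : Measurable fun m : ℕ => (m : ℝ≥0∞)) (measurable_fst.comp (h1 0))
    refine this.symm.trans ?_
    change ∫⁻ m, (m : ℝ≥0∞) ∂(Measure.map (fun ω : ℕ → ℕ × Fin k => (ω 0).1) _) = _
    rw [hA 0, lintegral_add_measure, lintegral_smul_measure, lintegral_smul_measure,
      lintegral_dirac, lintegral_dirac, smul_eq_mul, smul_eq_mul, Nat.cast_zero, mul_zero, add_zero]
    exact_mod_cast div_mul_cancel₀ rate hn0
  · exact iIndepFun_infinitePi (X := fun _ => Prod.snd) fun _ => measurable_snd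
  · have h2 := Measure.map_apply (μ := Measure.infinitePi fun _ : ℕ => Q)
      (measurable_snd.comp (h1 t)) (measurableSet_singleton l)
    refine h2.symm.trans ?_
    change Measure.map (fun ω : ℕ → ℕ × Fin k => (ω t).2) _ {l} = _
    rw [hL t, PMF.toMeasure_apply_singleton _ _ (measurableSet_singleton l)]
    rfl

namespace WirelessNetwork

section Capacity

variable {V : Type*} [Fintype V] [DecidableEq V] {N : WirelessNetwork V}

theorem exists_policy_isBroadcastOfRate (hdag : N.IsDAG) {k : ℕ} {M : Fin k → Finset N.links}
    {p : Fin k → ℝ} (hN : ∀ l, M l ∈ N.feasible) (hM : ∀ l, N.IsMatching (M l))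
    (hp : ∀ l, 0 ≤ p l) {rate : ℝ≥0}
    (hrate : (rate : ℝ≥0∞) ≤ N.minInflow (∑ l, p l • N.incidence (M l)))
    {Ω : Type*} [MeasurableSpace Ω] {P : Measure Ω} [IsProbabilityMeasure P] {A : ℕ → Ω → ℕ}
    {L : ℕ → Ω → Fin k} (hA : IsArrivalProcess P A rate) (hL : IsIIDSelection P L p) :
    ∃ pol : N.Policy A, (∀ t ω, pol.act t ω = M (L t ω)) ∧ pol.IsBroadcastOfRate P rate := by
  refine ⟨inOrderPolicy hN hM hA.measurable hL.measurable, fun _ _ => rfl, ?_⟩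
  have hL' : ∀ᵐ ω ∂P, ∀ e : N.links, Tendsto (fun T : ℕ =>
      (∑ t ∈ Finset.range T, if e ∈ M (L t ω) then (1 : ℝ) else 0) / T) atTop
      (nhds ((∑ l, p l • N.incidence (M l)) e)) := by
    refine ae_all_iff.2 fun e => ?_
    have := hL.ae_tendsto hp fun l => if e ∈ M l then (1 : ℝ) else 0
    convert this using 5
    rw [Finset.sum_apply]
    refine Finset.sum_congr rfl fun l _ => ?_
    simp [incidence, Set.indicator_apply]
  filter_upwards [hA.ae_tendsto, hL'] with ω hAω hLω
  simp only [received_inOrderPolicy]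
  -- The source itself receives at rate exactly `rate`, which bounds the minimum from above.
  refine le_antisymm (iInf_le_of_le N.source ?_) (le_iInf fun v => ?_)
  · simp only [inOrder_source]
    exact (liminf_natCast_div_of_tendsto hAω).le
  · refine (growsAtLeast_inOrder hdag rate.2 (GrowsAtLeast.of_tendsto_div hAω) hLω ?_ v).le_liminf
    intro w hw
    have h := hrate.trans (iInf₂_le w hw)
    rw [← ENNReal.ofReal_coe_nnreal] at h
    refine (ENNReal.ofReal_le_ofReal_iff (Finset.sum_nonneg fun e _ => ?_)).1 h
    refine mul_nonneg (Nat.cast_nonneg _) ?_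
    rw [Finset.sum_apply]
    exact Finset.sum_nonneg fun l _ => mul_nonneg (hp l)
      (Set.indicator_nonneg (fun _ _ => zero_le_one) _)

end Capacity

/-! ### The linear program over the matching polytope -/

section Optimum

variable {V : Type*} {N : WirelessNetwork V}

theorem incidence_mem_matchingPolytope {M : Finset N.links} (hM : N.IsMatching M) :
    N.incidence M ∈ N.matchingPolytope :=
  subset_convexHull ℝ _ ⟨M, hM, rfl⟩

theorem nonempty_matchingPolytope : N.matchingPolytope.Nonempty :=
  ⟨_, incidence_mem_matchingPolytope (M := ∅) fun e he => absurd he (Finset.notMem_empty e)⟩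

theorem isCompact_matchingPolytope : IsCompact N.matchingPolytope :=
  (Set.Finite.image _ (Set.toFinite _)).isCompact_convexHull ℝ

/-- An infimum of continuous functions is upper semicontinuous; with values in `[0, ∞]` this
includes the empty infimum. -/
theorem exists_isMaxOn_minInflow [DecidableEq V] :
    ∃ β ∈ N.matchingPolytope, IsMaxOn N.minInflow N.matchingPolytope β := by
  refine UpperSemicontinuousOn.exists_isMaxOn nonempty_matchingPolytope isCompact_matchingPolytope
    (UpperSemicontinuous.upperSemicontinuousOn ?_ _)
  refine upperSemicontinuous_biInf fun v _ => Continuous.upperSemicontinuous ?_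
  exact ENNReal.continuous_ofReal.comp (by fun_prop)

/-- Every point of the matching polytope is a convex combination of at most `|E| + 1` distinct
matchings with positive weights. -/
theorem exists_convex_combination {β : N.links → ℝ} (hβ : β ∈ N.matchingPolytope) :
    ∃ (k : ℕ) (M : Fin k → Finset N.links) (p : Fin k → ℝ), k ≤ N.links.card + 1 ∧
      Function.Injective M ∧ (∀ l, N.IsMatching (M l)) ∧ (∀ l, 0 < p l) ∧ ∑ l, p l = 1 ∧
      ∑ l, p l • N.incidence (M l) = β := by
  obtain ⟨ι, _, z, w, hz, hind, hw, hw1, hβ⟩ := eq_pos_convex_span_of_mem_convexHull hβ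
  choose M hM hMz using fun i => hz (Set.mem_range_self i)
  let e := (Fintype.equivFin ι).symm
  refine ⟨Fintype.card ι, M ∘ e, w ∘ e, ?_, ?_, fun l => hM _, fun l => hw _, ?_, ?_⟩
  -- Affine independence bounds the number of points by the dimension plus one, and below it makes
  -- the matchings distinct.
  · refine hind.card_le_finrank_succ.trans (Nat.add_le_add_right ?_ 1)
    refine (Submodule.finrank_le _).trans ?_
    simp
  · refine Function.Injective.comp (fun i j hij => hind.injective ?_) e.injective
    rw [← hMz, ← hMz, hij]
  · rw [← hw1]
    exact e.sum_comp w
  · rw [← hβ, ← e.sum_comp]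
    simp [hMz]

end Optimum

/-! ### The converse bound and the value of the capacity -/

section UpperBound

variable {V : Type*} [DecidableEq V] {N : WirelessNetwork V}

theorem Policy.received_le {Ω : Type*} [MeasurableSpace Ω] {A : ℕ → Ω → ℕ} (pol : N.Policy A)
    {v : V} (hv : v ≠ N.source) (T : ℕ) (ω : Ω) :
    pol.received v T ω ≤ ∑ t ∈ Finset.range T, N.inCap (pol.act t ω) v := by
  induction T with
  | zero => simp [received, held]
  | succ T ih =>
    rw [Finset.sum_range_succ, received, held, if_neg hv, Finset.union_empty]
    refine (Finset.card_union_le _ _).trans (add_le_add ih (Finset.card_biUnion_le.trans ?_))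
    refine Finset.sum_le_sum fun e _ => ?_
    split_ifs with h
    · exact pol.fwd_cap T ω e
    · rw [pol.fwd_act T ω e h, Finset.card_empty]

theorem natCast_inCap (M : Finset N.links) (v : V) :
    (N.inCap M v : ℝ) = ∑ e ∈ N.inLinks v, (N.cap e : ℝ) * N.incidence M e := by
  rw [inCap, Nat.cast_sum]
  refine Finset.sum_congr rfl fun e _ => ?_
  by_cases h : e ∈ M <;> simp [incidence, h]

theorem Policy.exists_received_div_le {Ω : Type*} [MeasurableSpace Ω] {A : ℕ → Ω → ℕ}
    (hprim : N.PrimaryInterference) (pol : N.Policy A) {T : ℕ} (hT : 0 < T) (ω : Ω) :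
    ∃ β ∈ N.matchingPolytope, ∀ v, v ≠ N.source → (pol.received v T ω : ℝ≥0∞) / T ≤
      ENNReal.ofReal (∑ e ∈ N.inLinks v, (N.cap e : ℝ) * β e) := by
  have hT' : (0 : ℝ) < T := by exact_mod_cast hT
  refine ⟨∑ t ∈ Finset.range T, (T : ℝ)⁻¹ • N.incidence (pol.act t ω),
    (convex_convexHull ℝ _).sum_mem (fun _ _ => by positivity) ?_ fun t _ => ?_, fun v hv => ?_⟩
  · rw [Finset.sum_const, Finset.card_range, nsmul_eq_mul, mul_inv_cancel₀ hT'.ne']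
  · refine incidence_mem_matchingPolytope ?_
    have := pol.act_feasible t ω
    rwa [hprim] at this
  · rw [← ENNReal.ofReal_natCast, ← ENNReal.ofReal_natCast, ← ENNReal.ofReal_div_of_pos hT']
    refine ENNReal.ofReal_le_ofReal ?_
    rw [div_le_iff₀ hT']
    have h : (pol.received v T ω : ℝ) ≤
        ((∑ t ∈ Finset.range T, N.inCap (pol.act t ω) v : ℕ) : ℝ) :=
      Nat.cast_le.2 (pol.received_le hv T ω)
    refine h.trans_eq ?_
    simp only [Nat.cast_sum, natCast_inCap, Finset.sum_apply, Pi.smul_apply, smul_eq_mul,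
      Finset.mul_sum, Finset.sum_mul]
    rw [Finset.sum_comm]
    refine Finset.sum_congr rfl fun e _ => Finset.sum_congr rfl fun t _ => ?_
    field_simp

theorem broadcastCapacity_le [Finite V] (hprim : N.PrimaryInterference) {β : N.links → ℝ}
    (hβ : IsMaxOn N.minInflow N.matchingPolytope β) :
    N.broadcastCapacity ≤ N.minInflow β := by
  refine iSup₂_le fun rate hrate => ?_
  obtain ⟨Ω, _, P, A, _, _, pol, hpol⟩ := hrate
  obtain ⟨ω, hω⟩ := hpol.exists
  rw [← hω]
  refine le_of_forall_lt fun x hx => ?_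
  obtain ⟨y, hxy, hy⟩ := exists_between hx
  -- As `V` is finite, one time `T` serves all nodes, hence one polytope point bounds them all.
  have h : ∀ᶠ T : ℕ in atTop, ∀ v, y < (pol.received v T ω : ℝ≥0∞) / T :=
    eventually_all.2 fun v => eventually_lt_of_lt_liminf (hy.trans_le (iInf_le _ v))
  obtain ⟨T, hT, hT0⟩ := (h.and (eventually_gt_atTop 0)).exists
  obtain ⟨γ, hγ, hle⟩ := pol.exists_received_div_le hprim hT0 ω
  have h' : y ≤ N.minInflow γ := le_iInf₂ fun v hv => (hT v).le.trans (hle v hv)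
  exact hxy.trans_le (h'.trans (hβ hγ))

theorem minInflow_eq_broadcastCapacity [Fintype V] (hdag : N.IsDAG) (hprim : N.PrimaryInterference) {k : ℕ}
    {M : Fin k → Finset N.links} {p : Fin k → ℝ} (hM : ∀ l, N.IsMatching (M l))
    (hp : ∀ l, 0 < p l) (hp1 : ∑ l, p l = 1)
    (hmax : IsMaxOn N.minInflow N.matchingPolytope (∑ l, p l • N.incidence (M l))) :
    N.minInflow (∑ l, p l • N.incidence (M l)) = N.broadcastCapacity := by
  -- Testing finite rates below the optimum also covers the value `∞`.
  refine le_antisymm (ENNReal.le_of_forall_nnreal_lt fun rate hrate => ?_)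
    (broadcastCapacity_le hprim hmax)
  obtain ⟨Ω, mΩ, P, A, L, hP, hA, hL⟩ :=
    exists_isArrivalProcess_isIIDSelection rate (fun l => (hp l).le) hp1
  obtain ⟨pol, -, hpol⟩ := exists_policy_isBroadcastOfRate hdag
    (fun l => hprim ▸ hM l) hM (fun l => (hp l).le) hrate.le hA hL
  exact le_iSup₂_of_le rate ⟨Ω, mΩ, P, A, hP, hA, pol, hpol⟩ le_rfl

end UpperBound

end WirelessNetwork

theorem mainTheorem7 {V : Type*} [Fintype V] [DecidableEq V] (N : WirelessNetwork V)
    (hdag : N.IsDAG) (hprim : N.PrimaryInterference) :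
    ∃ (k : ℕ) (M : Fin k → Finset N.links) (p : Fin k → ℝ),
      k ≤ N.links.card + 1 ∧ Function.Injective M ∧ (∀ l, N.IsMatching (M l)) ∧
      (∀ l, 0 < p l) ∧ ∑ l, p l = 1 ∧
      -- the average activation vector is an optimal solution of the linear program, of value `λ*`
      (∑ l, p l • N.incidence (M l)) ∈ N.matchingPolytope ∧
      IsMaxOn N.minInflow N.matchingPolytope (∑ l, p l • N.incidence (M l)) ∧
      N.minInflow (∑ l, p l • N.incidence (M l)) = N.broadcastCapacity ∧
      -- activating `M l` with probability `p l` in every slot achieves every rate up to `λ*`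
      ∀ (rate : ℝ≥0), (rate : ℝ≥0∞) ≤ N.broadcastCapacity →
        ∀ (Ω : Type*) [MeasurableSpace Ω] (P : Measure Ω) [IsProbabilityMeasure P]
          (A : ℕ → Ω → ℕ) (L : ℕ → Ω → Fin k),
          IsArrivalProcess P A rate → IsIIDSelection P L p →
            ∃ pol : N.Policy A, (∀ t ω, pol.act t ω = M (L t ω)) ∧
              pol.IsBroadcastOfRate P rate := by
  obtain ⟨β, hβ, hmax⟩ := WirelessNetwork.exists_isMaxOn_minInflow (N := N)
  obtain ⟨k, M, p, hk, hinj, hM, hp, hp1, rfl⟩ := WirelessNetwork.exists_convex_combination hβ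
  have hcap := WirelessNetwork.minInflow_eq_broadcastCapacity hdag hprim hM hp hp1 hmax
  refine ⟨k, M, p, hk, hinj, hM, hp, hp1, hβ, hmax, hcap, ?_⟩
  intro rate hrate Ω _ P _ A L hA hL
  exact WirelessNetwork.exists_policy_isBroadcastOfRate hdag (fun l => hprim ▸ hM l) hM
    (fun l => (hp l).le) (hrate.trans_eq hcap.symm) hA hL
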